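/- **Theorem 1 (Incipient Spanning Clusters occur).** Consider independent nearest-neighbor bond percolation, or independent nearest-neighbor site percolation, on $\mathbb Z^d$ with $d>1$. For each of the two models let $p_c$ be its critical point, i.e. the supremum of the densities $p\in[0,1]$ at which the cluster of the origin is almost surely finite. For real $L>0$ and $t\ge 0$ let $R_{L,t}$ be the probability at $p=p_c$ that the slab $S_{L,t}=[0,tL]\times[0,L]^{d-1}$ is traversed in the direction of the first coordinate, i.e. that an open lattice path with all its sites in $S_{L,t}$ joins the layer $\{x_1=0\}$ to the layer $\{x_1=\lfloor tL\rfloor\}$ (the first and last layers of lattice sites of the slab). For each of the two models there is a non-increasing function $h_d:[0,\infty)\to\mathbb R$, not depending on $L$, with $h_d(t)>0$ for all $0\le t<1/2$, such that $$R_{L,t}\ \ge\ h_d(t)\qquad\text{for all } t\ge 0 \text{ and all } 0<L<\infty .$$ Furthermore there are constants $A,c>0$ such that: * for bond percolation, $h_d$ can be chosen so that $h_d(t)\ge 1-A\,e^{-c\,t^{-(d-1)}}$ for all sufficiently small $t>0$; * for site percolation, for all sufficiently small $t>0$, $R_{L,t}\ge 1-A\,e^{-c\,t^{-(d-1)}}$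 for every $L$ with $tL\ge 1$ (that is, as soon as the slab is at least one lattice spacing thick). -/

import Mathlib

open MeasureTheory ProbabilityTheory Set Filter Topology

namespace Percolation

/-- The nearest-neighbor graph on `ℤ^d`: two sites are adjacent when their `ℓ¹` distance is `1`. -/
def lattice (d : ℕ) : SimpleGraph (Fin d → ℤ) where
  Adj x y := ∑ i, |x i - y i| = 1
  symm := ⟨fun x y h => by simpa only [abs_sub_comm] using h⟩
  loopless := ⟨fun x h => by simp at h⟩

/-- The law of independent bond percolation on `ℤ^d`: the random set of open bonds contains each
nearest-neighbor bond independently with probability `p`. -/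
noncomputable def bondLaw (d : ℕ) (p : unitInterval) : Measure (Set (Sym2 (Fin d → ℤ))) :=
  setBernoulli (lattice d).edgeSet p

/-- The law of independent site percolation on `ℤ^d`: the random set of open sites contains each
site independently with probability `p`. -/
noncomputable def siteLaw (d : ℕ) (p : unitInterval) : Measure (Set (Fin d → ℤ)) :=
  setBernoulli Set.univ p

/-- `x` and `y` are joined inside `S` by a lattice path all of whose bonds are open. -/
def BondJoined {d : ℕ} (ω : Set (Sym2 (Fin d → ℤ))) (S : Set (Fin d → ℤ)) (x y : Fin d → ℤ) :
    Prop :=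
  ∃ w : (lattice d).Walk x y, (∀ e ∈ w.edges, e ∈ ω) ∧ ∀ v ∈ w.support, v ∈ S

/-- `x` and `y` are joined inside `S` by a lattice path all of whose sites (both end points
included) are open. -/
def SiteJoined {d : ℕ} (ω : Set (Fin d → ℤ)) (S : Set (Fin d → ℤ)) (x y : Fin d → ℤ) : Prop :=
  ∃ w : (lattice d).Walk x y, (∀ v ∈ w.support, v ∈ ω) ∧ ∀ v ∈ w.support, v ∈ S

/-- The critical point of bond percolation: the supremum of the densities `p` at which the cluster
of the origin is almost surely finite. -/
noncomputable def bondPc (d : ℕ) : unitInterval :=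
  sSup {p | bondLaw d p {ω | {x | BondJoined ω Set.univ 0 x}.Infinite} = 0}

/-- The critical point of site percolation: the supremum of the densities `p` at which the cluster
of the origin is almost surely finite. -/
noncomputable def sitePc (d : ℕ) : unitInterval :=
  sSup {p | siteLaw d p {ω | {x | SiteJoined ω Set.univ 0 x}.Infinite} = 0}

/-- The lattice sites of the slab `[0, tL] × [0, L]^(d-1)`; the first coordinate has index `0`. -/
def slab (d : ℕ) (L t : ℝ) : Set (Fin d → ℤ) :=
  {x | ∀ i : Fin d, 0 ≤ x i ∧ (x i : ℝ) ≤ if (i : ℕ) = 0 then t * L else L}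

/-- The layer of sites whose first coordinate is `k`. -/
def layer (d : ℕ) (k : ℤ) : Set (Fin d → ℤ) :=
  {x | ∀ i : Fin d, (i : ℕ) = 0 → x i = k}

/-- The probability `R_{L,t}`, for bond percolation of density `p`, that the slab
`[0, tL] × [0, L]^(d-1)` is traversed in the direction of the first coordinate: an open path inside
the slab joins its first layer of sites `x₁ = 0` to its last layer of sites `x₁ = ⌊tL⌋`. -/
noncomputable def bondR (d : ℕ) (p : unitInterval) (L t : ℝ) : ℝ :=
  (bondLaw d p).real
    {ω | ∃ x ∈ layer d 0, ∃ y ∈ layer d ⌊t * L⌋, BondJoined ω (slab d L t) x y}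

/-- The probability `R_{L,t}`, for site percolation of density `p`, that the slab
`[0, tL] × [0, L]^(d-1)` is traversed in the direction of the first coordinate. -/
noncomputable def siteR (d : ℕ) (p : unitInterval) (L t : ℝ) : ℝ :=
  (siteLaw d p).real
    {ω | ∃ x ∈ layer d 0, ∃ y ∈ layer d ⌊t * L⌋, SiteJoined ω (slab d L t) x y}

end Percolation

/-! The argument is a finite-size criterion. Let θ be the probability that an infinite cluster meets
the inner cube `[m, N-m]^d`. Such a cluster must cross one of the `2d` slabs of thickness `m` along
the faces of `[0, N]^d`, an event inside that cube. It must also leave an infinite cluster in the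
complement of the cube, started from a site of the outer boundary. If `N + 3 ≤ q (N - 2m + 1)`, that
boundary is covered by `q^d` translates of the inner cube. The two events live on disjoint sets of
sites, so θ ≤ 2d R q^d θ, where R is the crossing probability of one slab. If `2d R q^d < 1`, then θ
= 0 and nothing percolates (`law_infin_eq_zero`).

For fixed `m` and `N`, R is a polynomial in the density, hence continuous. Were the strict
inequality true at the critical point, it would persist slightly above it, contradicting the
supremum. Hence R ≥ 1 / (2d q^d) at criticality (`le_crossProb_pc`). For aspect ratio `t < 1/2`, `q`
can be chosen from `t` alone (`crossBound_le`).

A flat slab contains order `t^{-(d-1)}` disjoint slabs of the same thickness and aspect ratio about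
1/4. They are crossed independently, each with probability bounded below, which gives the
exponential estimate (`exp_bound_le`). Bond and site percolation are handled together through
`Model`. -/

namespace Percolation

/-! ### Product Bernoulli laws: independence, symmetry, continuity in the density -/

section SetBernoulli

variable {ι : Type*}

/-- The σ-algebra on `Set ι` generated by the memberships of the elements of `A`. -/
@[reducible] def coordSigma (A : Set ι) : MeasurableSpace (Set ι) :=
  ⨆ i ∈ A, MeasurableSpace.comap (fun ω : Set ι => i ∈ ω) ⊤

/-- The one-coordinate marginal of `setBernoulli u p`. -/
noncomputable abbrev coordLaw (u : Set ι) (p : unitInterval) (i : ι) : Measure Prop :=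
  unitInterval.toNNReal p • Measure.dirac (i ∈ u) +
    unitInterval.toNNReal (unitInterval.symm p) • Measure.dirac False

lemma measurable_mem_coord (i : ι) : Measurable (fun ω : Set ι => i ∈ ω) := by
  fun_prop

lemma coordSigma_le (A : Set ι) : coordSigma A ≤ (inferInstance : MeasurableSpace (Set ι)) :=
  iSup₂_le fun i _ => (measurable_mem_coord i).comap_le

lemma coordSigma_mono {A B : Set ι} (h : A ⊆ B) : coordSigma A ≤ coordSigma B :=
  biSup_mono h

lemma measurableSet_mem_coordSigma {A : Set ι} {i : ι} (hi : i ∈ A) :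
    MeasurableSet[coordSigma A] {ω : Set ι | i ∈ ω} := by
  have h : MeasurableSpace.comap (fun ω : Set ι => i ∈ ω) ⊤ ≤ coordSigma A :=
    le_biSup (fun i => MeasurableSpace.comap (fun ω : Set ι => i ∈ ω) ⊤) hi
  refine h _ ⟨{True}, trivial, ?_⟩
  ext ω
  simp

lemma measurableSet_subset_coordSigma {A : Set ι} {F : Finset ι} (hF : (F : Set ι) ⊆ A) :
    MeasurableSet[coordSigma A] {ω : Set ι | (F : Set ι) ⊆ ω} := by
  have : {ω : Set ι | (F : Set ι) ⊆ ω} = ⋂ i ∈ F, {ω | i ∈ ω} := by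
    ext ω
    simp [Set.subset_def]
  rw [this]
  exact MeasurableSet.biInter (m := coordSigma A) F.countable_toSet
    fun i hi => measurableSet_mem_coordSigma (hF hi)

lemma map_mem_setBernoulli (u : Set ι) (p : unitInterval) :
    (setBernoulli u p).map (fun ω i => i ∈ ω) = Measure.infinitePi (coordLaw u p) := by
  have hm : Measurable (fun q : ι → Prop => {i | q i}) := MeasurableEquiv.setOfPred.measurable
  rw [setBernoulli_eq_map, Measure.map_map (by fun_prop) hm]
  exact Measure.map_id

lemma iIndepFun_mem (u : Set ι) (p : unitInterval) :
    iIndepFun (fun i (ω : Set ι) => i ∈ ω) (setBernoulli u p) := by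
  rw [iIndepFun_iff_map_fun_eq_infinitePi_map measurable_mem_coord, map_mem_setBernoulli]
  congr! with i
  rw [← Measure.infinitePi_map_eval (coordLaw u p) i, ← map_mem_setBernoulli,
    Measure.map_map (by fun_prop) (by fun_prop)]
  rfl

lemma indep_coordSigma (u : Set ι) (p : unitInterval) {A B : Set ι} (h : Disjoint A B) :
    Indep (coordSigma A) (coordSigma B) (setBernoulli u p) :=
  indep_iSup_of_disjoint (fun i => (measurable_mem_coord i).comap_le) (iIndepFun_mem u p) h

/-- A permutation of the coordinates that preserves `u` preserves `setBernoulli u p`. -/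
lemma setBernoulli_preimage_equiv {u : Set ι} (p : unitInterval) (e : ι ≃ ι)
    (hu : ∀ i, e i ∈ u ↔ i ∈ u) {S : Set (Set ι)} (hS : MeasurableSet S) :
    setBernoulli u p {ω | e ⁻¹' ω ∈ S} = setBernoulli u p S := by
  have hS' : MeasurableSet ((fun q : ι → Prop => {i | q i}) ⁻¹' S) :=
    MeasurableEquiv.setOfPred.measurable hS
  -- A marginal depends on its index only through membership in `u`, which `e` preserves.
  have hc : (fun i => coordLaw u p (e.symm i)) = coordLaw u p := by
    funext i
    simp only [coordLaw, ← hu (e.symm i), e.apply_symm_apply]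
  have h := Measure.infinitePi_map_piCongrLeft (μ := coordLaw u p) e.symm
  rw [hc] at h
  rw [setBernoulli_apply', setBernoulli_apply']
  conv_rhs => rw [← h]
  rw [Measure.map_apply (MeasurableEquiv.measurable _) hS']
  congr 1
  ext f
  have hf : MeasurableEquiv.piCongrLeft (fun _ => Prop) e.symm f = fun i => f (e i) := by
    funext i
    have h := Equiv.piCongrLeft_apply_apply (fun _ => Prop) e.symm f (e i)
    rw [e.symm_apply_apply] at h
    exact h
  simp only [mem_preimage, hf]
  rfl

lemma coordLaw_real (u : Set ι) (i : ι) (s : Set Prop) (p : unitInterval) :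
    (coordLaw u p i).real s =
      p * (Measure.dirac (i ∈ u)).real s + (1 - p) * (Measure.dirac False).real s := by
  rw [measureReal_add_apply]
  simp

lemma setBernoulli_real_agree (u : Set ι) (p : unitInterval) (J : Finset ι) (F : Set ι) :
    (setBernoulli u p).real {ω | ∀ i ∈ J, (i ∈ ω ↔ i ∈ F)} =
      ∏ i ∈ J, (coordLaw u p i).real {q | q ↔ i ∈ F} := by
  rw [measureReal_def, setBernoulli_apply']
  have h := Measure.infinitePi_pi (μ := coordLaw u p) (s := J) (t := fun i => {q | q ↔ i ∈ F})
    (fun _ _ => MeasurableSet.of_discrete)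
  simp only [measureReal_def]
  rw [← ENNReal.toReal_prod, ← h]
  rfl

/-- The probability of an event that depends on finitely many coordinates is continuous in `p`. -/
lemma continuous_setBernoulli_real (u : Set ι) (J : Finset ι) {A : Set (Set ι)}
    (hA : ∀ ω ω' : Set ι, (∀ i ∈ J, (i ∈ ω ↔ i ∈ ω')) → (ω ∈ A ↔ ω' ∈ A)) :
    Continuous fun p : unitInterval => (setBernoulli u p).real A := by
  classical
  -- `A` is a disjoint union of cylinders, one for each pattern `F ⊆ J` that belongs to `A` when
  -- everything outside it is closed. Its probability is thus a polynomial in `p`.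
  have hdec : A = ⋃ F ∈ J.powerset.filter (fun F : Finset ι => (F : Set ι) ∈ A),
      {ω : Set ι | ∀ i ∈ J, (i ∈ ω ↔ i ∈ (F : Set ι))} := by
    ext ω
    simp only [Finset.mem_filter, Finset.mem_powerset, mem_iUnion, exists_prop]
    constructor
    · intro h
      refine ⟨J.filter (· ∈ ω), ⟨Finset.filter_subset _ _, ?_⟩, ?_⟩
      · refine (hA ω _ ?_).1 h
        intro i hi; simp [hi]
      · intro i hi; simp [hi]
    · rintro ⟨F, ⟨-, hF⟩, h⟩
      exact (hA _ _ h).2 hF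
  have hmeas : ∀ F : Finset ι, MeasurableSet {ω : Set ι | ∀ i ∈ J, (i ∈ ω ↔ i ∈ (F : Set ι))} := by
    intro F
    have : {ω : Set ι | ∀ i ∈ J, (i ∈ ω ↔ i ∈ (F : Set ι))} =
        ⋂ i ∈ J, (fun ω : Set ι => i ∈ ω) ⁻¹' {q | q ↔ i ∈ F} := by
      ext ω; simp
    rw [this]
    exact Finset.measurableSet_biInter _ fun i _ => measurable_mem_coord i .of_discrete
  have hsum : ∀ p : unitInterval, (setBernoulli u p).real A =
      ∑ F ∈ J.powerset.filter (fun F : Finset ι => (F : Set ι) ∈ A),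
        ∏ i ∈ J, (p * (Measure.dirac (i ∈ u)).real {q | q ↔ i ∈ (F : Set ι)} +
          (1 - p) * (Measure.dirac False).real {q : Prop | q ↔ i ∈ (F : Set ι)} : ℝ) := by
    intro p
    conv_lhs => rw [hdec]
    rw [measureReal_biUnion_finset]
    · simp only [setBernoulli_real_agree, coordLaw_real]
    · intro F hF G hG hFG
      refine Set.disjoint_left.2 fun ω h1 h2 => hFG ?_
      simp only [Finset.coe_filter, Finset.mem_powerset, mem_ofPred_eq] at hF hG h1 h2
      ext i
      by_cases hi : i ∈ J
      · exact_mod_cast (h1 i hi).symm.trans (h2 i hi)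
      · exact ⟨fun h => (hi (hF.1 h)).elim, fun h => (hi (hG.1 h)).elim⟩
    · exact fun F _ => hmeas F
  simp only [hsum]
  fun_prop

end SetBernoulli

/-! ### Abstract percolation models and open paths -/

/-- A percolation model on `ℤ^d` with independent states of the elements of `ι`: the use of the site
`x` requires that the elements of `siteTok x` are open, and the use of the bond between `x` and `y`
that the elements of `bondTok x y` are. Only the elements of `base` can be open. The
elements of `ι` that pertain to a set `S` of sites are those of `loc S`. -/
structure Model (d : ℕ) (ι : Type*) where
  base : Set ι
  siteTok : (Fin d → ℤ) → Finset ι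
  bondTok : (Fin d → ℤ) → (Fin d → ℤ) → Finset ι
  loc : Set (Fin d → ℤ) → Set ι
  siteTok_base : ∀ x, (siteTok x : Set ι) ⊆ base
  bondTok_base : ∀ {x y}, (lattice d).Adj x y → (bondTok x y : Set ι) ⊆ base
  siteTok_subset : ∀ {x y}, (lattice d).Adj x y → siteTok y ⊆ bondTok x y
  siteTok_loc : ∀ {S x}, x ∈ S → (siteTok x : Set ι) ⊆ loc S
  bondTok_loc : ∀ {S x y}, x ∈ S → y ∈ S → (bondTok x y : Set ι) ⊆ loc S
  loc_mono : ∀ {S T}, S ⊆ T → loc S ⊆ loc T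
  loc_disjoint : ∀ {S T}, Disjoint S T → Disjoint (loc S) (loc T)
  loc_finite : ∀ {S}, S.Finite → (loc S).Finite
  aut : ∀ φ : lattice d ≃g lattice d, ∃ e : ι ≃ ι, (∀ i, e i ∈ base ↔ i ∈ base) ∧
    (∀ x, siteTok (φ x) = (siteTok x).map e.toEmbedding) ∧
    ∀ x y, bondTok (φ x) (φ y) = (bondTok x y).map e.toEmbedding

namespace Model

variable {d : ℕ} {ι : Type*} (M : Model d ι)

/-- One step of an open path inside `S`. -/
def Step (ω : Set ι) (S : Set (Fin d → ℤ)) (a b : Fin d → ℤ) : Prop :=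
  (lattice d).Adj a b ∧ a ∈ S ∧ b ∈ S ∧ (M.bondTok a b : Set ι) ⊆ ω

/-- `x` and `y` are joined by an open path inside `S`. -/
def Joined (ω : Set ι) (S : Set (Fin d → ℤ)) (x y : Fin d → ℤ) : Prop :=
  x ∈ S ∧ (M.siteTok x : Set ι) ⊆ ω ∧ Relation.ReflTransGen (M.Step ω S) x y

variable {M} {ω ω' : Set ι} {S T : Set (Fin d → ℤ)} {x y z : Fin d → ℤ}

lemma Joined.refl (hx : x ∈ S) (ho : (M.siteTok x : Set ι) ⊆ ω) : M.Joined ω S x x :=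
  ⟨hx, ho, .refl⟩

lemma Joined.tail (h : M.Joined ω S x y) (hs : M.Step ω S y z) : M.Joined ω S x z :=
  ⟨h.1, h.2.1, h.2.2.tail hs⟩

lemma Joined.mono (h : M.Joined ω S x y) (hω : ω ⊆ ω') (hS : S ⊆ T) : M.Joined ω' T x y :=
  ⟨hS h.1, h.2.1.trans hω,
    Relation.ReflTransGen.mono (fun _ _ hs => ⟨hs.1, hS hs.2.1, hS hs.2.2.1, hs.2.2.2.trans hω⟩) _ _ h.2.2⟩

lemma Step.siteTok_right (h : M.Step ω S x y) : (M.siteTok y : Set ι) ⊆ ω :=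
  (Finset.coe_subset.2 (M.siteTok_subset h.1)).trans h.2.2.2

@[elab_as_elim]
lemma Joined.induct {P : ∀ y, M.Joined ω S x y → Prop}
    (refl : ∀ (hx : x ∈ S) (ho : (M.siteTok x : Set ι) ⊆ ω), P x (.refl hx ho))
    (tail : ∀ b c (hb : M.Joined ω S x b) (hs : M.Step ω S b c), P b hb → P c (hb.tail hs))
    {y} (h : M.Joined ω S x y) : P y h := by
  obtain ⟨hx, ho, hr⟩ := h
  induction hr with
  | refl => exact refl hx ho
  | tail hab hbc ih => exact tail _ _ ⟨hx, ho, hab⟩ hbc ih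

lemma Joined.right_mem (h : M.Joined ω S x y) : y ∈ S := by
  induction h using Joined.induct with
  | refl hx => exact hx
  | tail _ _ _ hs => exact hs.2.2.1

/-- A path consults finitely many elements, all pertaining to `S`. Measurability, locality and
continuity of the path events all rest on this. -/
lemma Joined.finitary (h : M.Joined ω S x y) :
    ∃ F : Finset ι, (F : Set ι) ⊆ ω ∧ (F : Set ι) ⊆ M.loc S ∧ M.Joined F S x y := by
  classical
  induction h using Joined.induct with
  | refl hx ho => exact ⟨M.siteTok x, ho, M.siteTok_loc hx, .refl hx subset_rfl⟩
  | tail b c _ hs ih =>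
    obtain ⟨F, h1, h2, h3⟩ := ih
    refine ⟨F ∪ M.bondTok b c, ?_, ?_, ?_⟩
    · simpa using ⟨h1, hs.2.2.2⟩
    · simpa using ⟨h2, M.bondTok_loc hs.2.1 hs.2.2.1⟩
    · refine (h3.mono (by simp) subset_rfl).tail ⟨hs.1, hs.2.1, hs.2.2.1, by simp⟩

lemma joined_map_iff {φ : lattice d ≃g lattice d} {e : ι ≃ ι}
    (hv : ∀ x, M.siteTok (φ x) = (M.siteTok x).map e.toEmbedding)
    (hb : ∀ x y, M.bondTok (φ x) (φ y) = (M.bondTok x y).map e.toEmbedding) :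
    M.Joined ω T (φ x) (φ y) ↔ M.Joined (e ⁻¹' ω) (φ ⁻¹' T) x y := by
  have hstep : ∀ a b, M.Step ω T (φ a) (φ b) ↔ M.Step (e ⁻¹' ω) (φ ⁻¹' T) a b := by
    intro a b
    simp [Step, hb, φ.map_adj_iff]
  have hsite : (M.siteTok (φ x) : Set ι) ⊆ ω ↔ (M.siteTok x : Set ι) ⊆ e ⁻¹' ω := by
    simp [hv]
  refine and_congr Iff.rfl (and_congr hsite ⟨fun h => ?_, fun h => ?_⟩)
  · have := Relation.ReflTransGen.lift (p := M.Step (e ⁻¹' ω) (φ ⁻¹' T)) φ.symm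
      (fun a b hab => (hstep _ _).1 (by simpa using hab)) _ _ h
    simpa [Function.onFun] using this
  · exact Relation.ReflTransGen.lift (p := M.Step ω T) φ (fun a b hab => (hstep a b).2 hab) _ _ h

/-- The event that some site of `A` is joined to some site of `B` inside `S`. -/
def Cross (M : Model d ι) (S A B : Set (Fin d → ℤ)) : Set (Set ι) :=
  {ω | ∃ x ∈ A, ∃ y ∈ B, M.Joined ω S x y}

/-- The event that some site of `A` has an infinite cluster inside `S`. -/
def Infin (M : Model d ι) (S A : Set (Fin d → ℤ)) : Set (Set ι) :=
  {ω | ∃ x ∈ A, {y | M.Joined ω S x y}.Infinite}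

/-- The law of the set of open elements at density `p`. -/
noncomputable abbrev law (M : Model d ι) (p : unitInterval) : Measure (Set ι) :=
  setBernoulli M.base p

/-- Events inside disjoint sets of sites are independent. -/
lemma law_inter (M : Model d ι) (p : unitInterval) {S T : Set (Fin d → ℤ)} (h : Disjoint S T)
    {E F : Set (Set ι)} (hE : MeasurableSet[coordSigma (M.loc S)] E)
    (hF : MeasurableSet[coordSigma (M.loc T)] F) :
    (M.law p).real (E ∩ F) = (M.law p).real E * (M.law p).real F := by
  simp only [measureReal_def, ← ENNReal.toReal_mul]
  rw [Indep_iff _ _ _ |>.1 (indep_coordSigma M.base p (M.loc_disjoint h)) E F hE hF]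

/-- The probability that none of several events inside disjoint sets of sites occurs. -/
lemma law_iInter_compl (M : Model d ι) (p : unitInterval) {α : Type*} (s : Finset α)
    {S : α → Set (Fin d → ℤ)} (hS : Pairwise fun a b => Disjoint (S a) (S b))
    {E : α → Set (Set ι)} (hE : ∀ a, MeasurableSet[coordSigma (M.loc (S a))] (E a)) :
    (M.law p).real (⋂ a ∈ s, (E a)ᶜ) = ∏ a ∈ s, (1 - (M.law p).real (E a)) := by
  classical
  induction s using Finset.induction_on with
  | empty => simp
  | insert a s ha ih =>
    rw [Finset.set_biInter_insert, Finset.prod_insert ha, ← ih,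
      ← probReal_compl_eq_one_sub (coordSigma_le _ _ (hE a))]
    refine M.law_inter p (S := S a) (T := ⋃ b ∈ s, S b) ?_ (MeasurableSet.compl (hE a)) ?_
    · simp only [disjoint_iUnion_right]
      exact fun b hb => hS fun h => ha (h ▸ hb)
    · refine Finset.measurableSet_biInter (m := coordSigma (M.loc (⋃ b ∈ s, S b))) s fun b hb => ?_
      refine MeasurableSet.compl (m := coordSigma (M.loc (⋃ b ∈ s, S b))) ?_
      exact coordSigma_mono (M.loc_mono (subset_biUnion_of_mem (u := S) hb)) _ (hE b)

section Measurable

variable [Countable ι]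

lemma measurableSet_joined (M : Model d ι) (S : Set (Fin d → ℤ)) (x y : Fin d → ℤ) :
    MeasurableSet[coordSigma (M.loc S)] {ω | M.Joined ω S x y} := by
  have : {ω | M.Joined ω S x y} =
      ⋃ F : {F : Finset ι // (F : Set ι) ⊆ M.loc S ∧ M.Joined F S x y},
        {ω | ((F : Finset ι) : Set ι) ⊆ ω} := by
    ext ω
    simp only [mem_ofPred_eq, mem_iUnion, Subtype.exists, exists_prop]
    constructor
    · intro h
      obtain ⟨F, h1, h2, h3⟩ := h.finitary
      exact ⟨F, ⟨h2, h3⟩, h1⟩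
    · rintro ⟨F, ⟨-, h3⟩, h1⟩
      exact h3.mono h1 subset_rfl
  rw [this]
  exact MeasurableSet.iUnion (m := coordSigma (M.loc S))
    fun F => measurableSet_subset_coordSigma F.2.1

lemma measurableSet_cross (M : Model d ι) (S A B : Set (Fin d → ℤ)) :
    MeasurableSet[coordSigma (M.loc S)] (M.Cross S A B) := by
  have : M.Cross S A B = ⋃ x ∈ A, ⋃ y ∈ B, {ω | M.Joined ω S x y} := by
    ext ω; simp [Cross]
  rw [this]
  exact MeasurableSet.biUnion (m := coordSigma (M.loc S)) A.to_countable fun x _ =>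
    MeasurableSet.biUnion (m := coordSigma (M.loc S)) B.to_countable fun y _ =>
      M.measurableSet_joined S x y

lemma measurableSet_infin (M : Model d ι) (S A : Set (Fin d → ℤ)) :
    MeasurableSet[coordSigma (M.loc S)] (M.Infin S A) := by
  -- A set is infinite exactly when no finite set contains it, which uses only countable operations.
  have : M.Infin S A = ⋃ x ∈ A, ⋂ F : Finset (Fin d → ℤ), ⋃ y ∈ (F : Set (Fin d → ℤ))ᶜ,
      {ω | M.Joined ω S x y} := by
    ext ω
    simp only [Infin, mem_ofPred_eq, mem_iUnion, mem_iInter, exists_prop]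
    refine exists_congr fun x => and_congr Iff.rfl ⟨fun h F => ?_, fun h hf => ?_⟩
    · obtain ⟨y, hy, hyF⟩ := h.exists_notMem_finset F
      exact ⟨y, by simpa using hyF, hy⟩
    · obtain ⟨y, hyF, hy⟩ := h hf.toFinset
      simp at hyF
      exact hyF hy
  rw [this]
  refine MeasurableSet.biUnion (m := coordSigma (M.loc S)) A.to_countable fun x _ =>
    MeasurableSet.iInter (m := coordSigma (M.loc S)) fun F =>
    MeasurableSet.biUnion (m := coordSigma (M.loc S)) (to_countable _) fun y _ =>
      M.measurableSet_joined S x y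

lemma law_cross_preimage (M : Model d ι) (p : unitInterval) (φ : lattice d ≃g lattice d)
    (S A B : Set (Fin d → ℤ)) :
    (M.law p).real (M.Cross (φ ⁻¹' S) (φ ⁻¹' A) (φ ⁻¹' B)) = (M.law p).real (M.Cross S A B) := by
  obtain ⟨e, he, hv, hb⟩ := M.aut φ
  rw [measureReal_def, measureReal_def, ← setBernoulli_preimage_equiv p e he
    (coordSigma_le _ _ (M.measurableSet_cross _ _ _))]
  congr 2
  ext ω
  simp only [Cross, mem_ofPred_eq, ← joined_map_iff hv hb, mem_preimage]
  constructor
  · rintro ⟨x, hx, y, hy, h⟩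
    exact ⟨_, hx, _, hy, h⟩
  · rintro ⟨x, hx, y, hy, h⟩
    exact ⟨φ.symm x, by simpa using hx, φ.symm y, by simpa using hy, by simpa using h⟩

lemma law_infin_preimage (M : Model d ι) (p : unitInterval) (φ : lattice d ≃g lattice d)
    (S A : Set (Fin d → ℤ)) :
    (M.law p).real (M.Infin (φ ⁻¹' S) (φ ⁻¹' A)) = (M.law p).real (M.Infin S A) := by
  obtain ⟨e, he, hv, hb⟩ := M.aut φ
  rw [measureReal_def, measureReal_def, ← setBernoulli_preimage_equiv p e he
    (coordSigma_le _ _ (M.measurableSet_infin _ _))]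
  congr 2
  ext ω
  simp only [Infin, mem_ofPred_eq, ← joined_map_iff hv hb, mem_preimage]
  have key : ∀ x, {y | M.Joined ω S (φ x) (φ y)}.Infinite ↔ {y | M.Joined ω S (φ x) y}.Infinite := by
    intro x
    rw [← Set.infinite_image_iff (s := {y | M.Joined ω S (φ x) (φ y)}) φ.injective.injOn]
    congr! 1
    ext y
    constructor
    · rintro ⟨z, hz, rfl⟩; exact hz
    · intro h; exact ⟨φ.symm y, by simpa using h, by simp⟩
  simp only [key]
  constructor
  · rintro ⟨x, hx, h⟩
    exact ⟨_, hx, h⟩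
  · rintro ⟨x, hx, h⟩
    exact ⟨φ.symm x, by simpa using hx, by simpa using h⟩

end Measurable

/-- The probability of a crossing of a finite set of sites is continuous in the density. -/
lemma continuous_law_cross (M : Model d ι) (hS : S.Finite) (A B : Set (Fin d → ℤ)) :
    Continuous fun p => (M.law p).real (M.Cross S A B) := by
  refine continuous_setBernoulli_real _ (M.loc_finite hS).toFinset ?_
  have key : ∀ ω ω' : Set ι, (∀ i ∈ (M.loc_finite hS).toFinset, (i ∈ ω ↔ i ∈ ω')) →
      ω ∈ M.Cross S A B → ω' ∈ M.Cross S A B := by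
    rintro ω ω' h ⟨x, hx, y, hy, hj⟩
    obtain ⟨F, h1, h2, h3⟩ := hj.finitary
    exact ⟨x, hx, y, hy, h3.mono (fun i hi => (h i (by simpa using h2 hi)).1 (h1 hi)) subset_rfl⟩
  exact fun ω ω' h => ⟨key ω ω' h, key ω' ω fun i hi => (h i hi).symm⟩

/-- An open path that leaves `B` has an initial piece inside `B` up to the boundary of `B`. -/
lemma Joined.exists_exit {B : Set (Fin d → ℤ)} (h : M.Joined ω univ x z) (hx : x ∈ B) (hz : z ∉ B) :
    ∃ y, (∃ y', y' ∉ B ∧ (lattice d).Adj y y') ∧ y ∈ B ∧ M.Joined ω B x y := by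
  -- Along the path, either it has stayed in `B` so far, or an exit site has already been recorded.
  have key : M.Joined ω B x z ∨
      ∃ y, (∃ y', y' ∉ B ∧ (lattice d).Adj y y') ∧ y ∈ B ∧ M.Joined ω B x y := by
    clear hz
    induction h using Joined.induct with
    | refl _ ho => exact .inl (.refl hx ho)
    | tail b c _ hs ih =>
      rcases ih with ih | ih
      · by_cases hc : c ∈ B
        · exact .inl (ih.tail ⟨hs.1, ih.right_mem, hc, hs.2.2.2⟩)
        · exact .inr ⟨b, ⟨c, hc, hs.1⟩, ih.right_mem, ih⟩
      · exact .inr ih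
  exact key.resolve_left fun hj => hz hj.right_mem

/-- An open path from `{m ≤ f}` into `{f ≤ m}` has a final piece inside `{f ≤ m}` that starts on
`{f = m}`. -/
lemma Joined.exists_last_entrance {f : (Fin d → ℤ) → ℤ} {m : ℤ}
    (hf : ∀ a b, (lattice d).Adj a b → f a ≤ f b + 1)
    (h : M.Joined ω S x y) (hx : m ≤ f x) (hy : f y ≤ m) :
    ∃ a, f a = m ∧ M.Joined ω (S ∩ {v | f v ≤ m}) a y := by
  induction h using Joined.induct with
  | refl hxS ho => exact ⟨x, le_antisymm hy hx, .refl ⟨hxS, hy⟩ ho⟩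
  | tail b c _ hs ih =>
    by_cases hb : f b ≤ m
    · obtain ⟨a, ha, hj⟩ := ih hb
      exact ⟨a, ha, hj.tail ⟨hs.1, ⟨hs.2.1, hb⟩, ⟨hs.2.2.1, hy⟩, hs.2.2.2⟩⟩
    -- Here the step enters `{f ≤ m}` from above; as `f` drops by at most 1, `f c = m`, and the
    -- final piece restarts at `c`.
    · have := hf b c hs.1
      exact ⟨c, by omega, .refl ⟨hs.2.2.1, hy⟩ hs.siteTok_right⟩

/-- The sites outside `B` that are adjacent to `B`. -/
def outerBoundary (B : Set (Fin d → ℤ)) : Set (Fin d → ℤ) :=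
  {y | y ∉ B ∧ ∃ y' ∈ B, (lattice d).Adj y' y}

/-- If a site of a finite set `B` has an infinite cluster, then some site of the outer boundary of
`B` has an infinite cluster in the complement of `B`. -/
lemma exists_infinite_compl {B : Set (Fin d → ℤ)} (hB : B.Finite)
    (hB' : (outerBoundary B).Finite) (hx : x ∈ B) (h : {y | M.Joined ω univ x y}.Infinite) :
    ∃ y ∈ outerBoundary B, {z | M.Joined ω Bᶜ y z}.Infinite := by
  by_contra! hcon
  -- Otherwise the whole cluster lies in `B` together with finitely many finite clusters: each time
  -- a path leaves `B`, it does so through the outer boundary.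
  refine h ((hB.union (hB'.biUnion fun y hy => hcon y hy)).subset fun z hz => ?_)
  induction (hz : M.Joined ω univ x z) using Joined.induct with
  | refl => exact .inl hx
  | tail b c hb hs ih =>
    by_cases hc : c ∈ B
    · exact .inl hc
    · right
      rcases ih with ih | ih
      · exact mem_biUnion (x := c) ⟨hc, b, ih, hs.1⟩ (Joined.refl hc hs.siteTok_right)
      · simp only [mem_iUnion, exists_prop] at ih ⊢
        obtain ⟨y, hy, hj⟩ := ih
        have hbB : b ∈ Bᶜ := Joined.right_mem hj
        exact ⟨y, hy, Joined.tail hj ⟨hs.1, hbB, hc, hs.2.2.2⟩⟩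

end Model

/-! ### Lattice symmetries, slabs and cubes -/

section Automorphisms

variable {d : ℕ}

/-- Translation by `v`. -/
def translateIso (v : Fin d → ℤ) : lattice d ≃g lattice d where
  toEquiv := Equiv.addRight v
  map_rel_iff' := by intro a b; simp [lattice]

@[simp]
lemma translateIso_apply (v x : Fin d → ℤ) : translateIso v x = x + v := rfl

/-- Permutation of the coordinates. -/
def permIso (σ : Equiv.Perm (Fin d)) : lattice d ≃g lattice d where
  toFun x := x ∘ σ
  invFun x := x ∘ σ.symm
  left_inv x := by ext; simp
  right_inv x := by ext; simp
  map_rel_iff' := by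
    intro a b
    simp only [lattice, Equiv.coe_fn_mk, Function.comp_apply]
    rw [Equiv.sum_comp σ fun i => |a i - b i|]

/-- The reflection that maps the coordinate `x i` to `m - x i`. -/
def reflectIso (i : Fin d) (m : ℤ) : lattice d ≃g lattice d where
  toFun x j := if j = i then m - x j else x j
  invFun x j := if j = i then m - x j else x j
  left_inv x := by ext j; by_cases h : j = i <;> simp [h]
  right_inv x := by ext j; by_cases h : j = i <;> simp [h]
  map_rel_iff' := by
    intro a b
    simp only [lattice, Equiv.coe_fn_mk]
    rw [Finset.sum_congr rfl fun j _ => ?_]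
    by_cases h : j = i
    · simp only [h, if_true]
      rw [abs_sub_comm]
      congr 1
      ring
    · simp [h]

lemma abs_coord_sub_le {a b : Fin d → ℤ} (h : (lattice d).Adj a b) (i : Fin d) :
    |a i - b i| ≤ 1 := by
  have h' : ∑ j, |a j - b j| = 1 := h
  rw [← h']
  exact Finset.single_le_sum (f := fun j => |a j - b j|) (fun j _ => abs_nonneg _)
    (Finset.mem_univ i)

end Automorphisms

section Boxes

variable {d : ℕ}

/-- The sites of `ℤ^d` with `0 ≤ x j ≤ m` for `j = i` and `0 ≤ x j ≤ N` for `j ≠ i`. -/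
def slabZ (i : Fin d) (m N : ℤ) : Set (Fin d → ℤ) :=
  {x | ∀ j, 0 ≤ x j ∧ x j ≤ if j = i then m else N}

/-- The sites whose coordinate `i` is `k`. -/
def face (i : Fin d) (k : ℤ) : Set (Fin d → ℤ) := {x | x i = k}

/-- The cube of the sites all of whose coordinates are in `[a, b]`. -/
def cube (d : ℕ) (a b : ℤ) : Set (Fin d → ℤ) := Icc (fun _ => a) (fun _ => b)

lemma mem_cube {a b : ℤ} {x : Fin d → ℤ} : x ∈ cube d a b ↔ ∀ j, a ≤ x j ∧ x j ≤ b := by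
  simp [cube, Pi.le_def, forall_and]

lemma cube_finite (a b : ℤ) : (cube d a b).Finite := Set.finite_Icc _ _

lemma slabZ_finite (i : Fin d) (m N : ℤ) : (slabZ i m N).Finite := by
  refine (Set.finite_Icc (fun _ => 0) fun j => if j = i then m else N).subset fun x hx => ?_
  exact ⟨fun j => (hx j).1, fun j => (hx j).2⟩

lemma outerBoundary_cube_subset (N : ℤ) :
    Model.outerBoundary (cube d 0 N) ⊆ cube d (-1) (N + 1) := by
  rintro y ⟨-, y', hy', h⟩
  rw [mem_cube] at hy' ⊢
  intro j
  have := abs_le.1 (abs_coord_sub_le h j)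
  have := hy' j
  constructor <;> omega

end Boxes

/-! ### The finite-size criterion -/

namespace Model

variable {d : ℕ} {ι : Type*} (M : Model d ι) (p : unitInterval)

/-- The probability that the slab `slabZ i m N` is crossed in the direction `i`. -/
noncomputable def crossProb (i : Fin d) (m N : ℤ) : ℝ :=
  (M.law p).real (M.Cross (slabZ i m N) (face i 0) (face i m))

/-- The event that a slab at the low side of the cube `[0, N]^d` in direction `i` is crossed. -/
def lowCross (i : Fin d) (m N : ℤ) : Set (Set ι) :=
  M.Cross (cube d 0 N ∩ {x | x i ≤ m}) (face i m) (face i 0)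

/-- The event that a slab at the high side of the cube `[0, N]^d` in direction `i` is crossed. -/
def highCross (i : Fin d) (m N : ℤ) : Set (Set ι) :=
  M.Cross (cube d 0 N ∩ {x | N - x i ≤ m}) (face i (N - m)) (face i N)

/-- A slab near the boundary of the cube `[0, N]^d` is crossed. -/
def shellCross (m N : ℤ) : Set (Set ι) :=
  ⋃ i : Fin d, M.lowCross i m N ∪ M.highCross i m N

/-- An infinite cluster that meets the cube `[m, N - m]^d` crosses a slab near the boundary of
`[0, N]^d`. -/
lemma infin_subset_shellCross {m N : ℤ} (hm : 0 ≤ m) :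
    M.Infin univ (cube d m (N - m)) ⊆ M.shellCross m N := by
  rintro ω ⟨x, hx, hinf⟩
  rw [mem_cube] at hx
  have hxB : x ∈ cube d 0 N := mem_cube.2 fun j => by have := hx j; constructor <;> omega
  obtain ⟨z, hz, hzB⟩ := hinf.exists_notMem_finite (cube_finite (d := d) 0 N)
  obtain ⟨y, ⟨y', hy', hadj⟩, hyB, hj⟩ := Joined.exists_exit hz hxB hzB
  rw [mem_cube] at hyB hy'
  push Not at hy'
  obtain ⟨i, hi⟩ := hy'
  have hi' := abs_le.1 (abs_coord_sub_le hadj i)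
  have hxi := hx i
  have hyi := hyB i
  refine mem_iUnion.2 ⟨i, ?_⟩
  have hlip : ∀ a b : Fin d → ℤ, (lattice d).Adj a b → a i ≤ b i + 1 ∧ N - a i ≤ N - b i + 1 :=
    fun a b hab => by
      have := abs_le.1 (abs_coord_sub_le hab i)
      constructor <;> omega
  -- The exit site lies on the low or the high face in direction `i`, while `x` is at distance at
  -- least `m` from both; the last entrance into the corresponding slab gives the crossing.
  by_cases h0 : y i = 0
  · obtain ⟨a, ha, hja⟩ := hj.exists_last_entrance (f := fun v => v i) (m := m)
      (fun a b hab => (hlip a b hab).1) hxi.1 (by omega)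
    exact .inl ⟨a, ha, y, h0, hja⟩
  · have hN : y i = N := by
      by_contra hne
      have := hi (by omega)
      omega
    obtain ⟨a, ha, hja⟩ := hj.exists_last_entrance (f := fun v => N - v i) (m := m)
      (fun a b hab => (hlip a b hab).2) (by omega) (by omega)
    refine .inr ⟨a, ?_, y, hN, hja⟩
    change a i = N - m
    omega

lemma law_infin_mono {S T A : Set (Fin d → ℤ)} (h : S ⊆ T) :
    (M.law p).real (M.Infin S A) ≤ (M.law p).real (M.Infin T A) := by
  refine measureReal_mono ?_
  rintro ω ⟨x, hx, hinf⟩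
  exact ⟨x, hx, hinf.mono fun y (hy : M.Joined ω S x y) => hy.mono subset_rfl h⟩

variable [Countable ι]

lemma crossProb_eq (i j : Fin d) (m N : ℤ) : M.crossProb p i m N = M.crossProb p j m N := by
  rw [crossProb, crossProb, ← M.law_cross_preimage p (permIso (Equiv.swap i j)) (slabZ i m N)]
  have h : (permIso (Equiv.swap i j)) ⁻¹' slabZ i m N = slabZ j m N := by
    ext x
    simp only [slabZ, permIso, mem_preimage, mem_ofPred_eq, RelIso.coe_fn_mk, Equiv.coe_fn_mk,
      Function.comp_apply]
    rw [← (Equiv.swap i j).forall_congr_right]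
    simp [Equiv.swap_apply_eq_iff]
  have hf : ∀ k, (permIso (Equiv.swap i j)) ⁻¹' face i k = face j k := by
    intro k
    ext x
    simp [face, permIso]
  rw [h, hf, hf]

/-- The reflection `x i ↦ m - x i` preserves the slab and exchanges its two faces, turning the
outward crossing into the standard one. -/
lemma law_lowCross (i : Fin d) {m N : ℤ} (hmN : m ≤ N) :
    (M.law p).real (M.lowCross i m N) = M.crossProb p i m N := by
  rw [crossProb, lowCross, ← M.law_cross_preimage p (reflectIso i m)]
  congr 2
  · ext x
    simp only [reflectIso, mem_preimage, mem_inter_iff, mem_cube, mem_ofPred_eq, slabZ,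
      RelIso.coe_fn_mk, Equiv.coe_fn_mk]
    constructor
    · rintro ⟨h, h'⟩ j
      have := h j
      by_cases hj : j = i
      · subst hj; simp at this h' ⊢; omega
      · simpa [hj] using this
    · intro h
      refine ⟨fun j => ?_, ?_⟩
      · have := h j
        by_cases hj : j = i
        · subst hj; simp at this ⊢; omega
        · simpa [hj] using this
      · have := h i
        simp at this ⊢; omega
  · ext x; simp [face, reflectIso]
  · ext x; simp [face, reflectIso]; omega

lemma law_highCross (i : Fin d) {m N : ℤ} (hmN : m ≤ N) :
    (M.law p).real (M.highCross i m N) = M.crossProb p i m N := by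
  rw [crossProb, highCross, ← M.law_cross_preimage p (translateIso (Pi.single i (N - m)))]
  congr 2
  · ext x
    simp only [translateIso_apply, mem_preimage, mem_inter_iff, mem_cube, mem_ofPred_eq, slabZ,
      Pi.add_apply]
    constructor
    · rintro ⟨h, h'⟩ j
      have := h j
      by_cases hj : j = i
      · subst hj; simp at this h' ⊢; omega
      · simpa [hj] using this
    · intro h
      refine ⟨fun j => ?_, ?_⟩
      · have := h j
        by_cases hj : j = i
        · subst hj; simp at this ⊢; omega
        · simpa [hj] using this
      · have := h i
        simp at this ⊢; omega
  · ext x; simp [face]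
  · ext x; simp [face]; omega

lemma measurableSet_shellCross (m N : ℤ) :
    MeasurableSet[coordSigma (M.loc (cube d 0 N))] (M.shellCross m N) := by
  refine MeasurableSet.iUnion (m := coordSigma (M.loc (cube d 0 N))) fun i =>
    MeasurableSet.union (m := coordSigma (M.loc (cube d 0 N))) ?_ ?_
  · exact coordSigma_mono (M.loc_mono inter_subset_left) _ (M.measurableSet_cross _ _ _)
  · exact coordSigma_mono (M.loc_mono inter_subset_left) _ (M.measurableSet_cross _ _ _)

lemma law_shellCross_le (i₀ : Fin d) {m N : ℤ} (hmN : m ≤ N) :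
    (M.law p).real (M.shellCross m N) ≤ 2 * d * M.crossProb p i₀ m N := by
  calc (M.law p).real (M.shellCross m N)
      ≤ ∑ i : Fin d, (M.law p).real (M.lowCross i m N ∪ M.highCross i m N) :=
        measureReal_iUnion_fintype_le _
    _ ≤ ∑ i : Fin d, (M.crossProb p i₀ m N + M.crossProb p i₀ m N) := by
        refine Finset.sum_le_sum fun i _ => (measureReal_union_le _ _).trans_eq ?_
        rw [law_lowCross M p i hmN, law_highCross M p i hmN, crossProb_eq M p i i₀]
    _ = 2 * d * M.crossProb p i₀ m N := by simp; ring

lemma law_infin_translate (v : Fin d → ℤ) (A : Set (Fin d → ℤ)) :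
    (M.law p).real (M.Infin univ ((· + v) ⁻¹' A)) = (M.law p).real (M.Infin univ A) :=
  M.law_infin_preimage p (translateIso v) univ A

/-- The finite-size criterion: if a crossing of the slab is unlikely enough, then there is no
infinite cluster. -/
theorem law_infin_eq_zero (i₀ : Fin d) {m N : ℤ} (hm : 0 ≤ m) (hmN : 2 * m ≤ N) {q : ℕ}
    (hq : N + 3 ≤ q * (N - 2 * m + 1)) (hR : 2 * d * M.crossProb p i₀ m N * q ^ d < 1) :
    M.law p (M.Infin univ {0}) = 0 := by
  set θ := (M.law p).real (M.Infin univ (cube d m (N - m))) with hθ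
  set s := N - 2 * m + 1 with hs
  -- Cells of `s` sites per side tile space from the corner `-1` of `[-1, N+1]^d`. The shift by `-m`
  -- compensates for the inner cube starting at `m`.
  let v : (Fin d → Fin q) → Fin d → ℤ := fun a j => -1 + s * (a j : ℕ) - m
  let K : (Fin d → Fin q) → Set (Fin d → ℤ) := fun a => (· - v a) ⁻¹' cube d m (N - m)
  have hcover : M.Infin univ (cube d m (N - m)) ⊆
      M.shellCross m N ∩ ⋃ a, M.Infin (cube d 0 N)ᶜ (K a) := by
    intro ω hω
    refine ⟨M.infin_subset_shellCross hm hω, ?_⟩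
    obtain ⟨x, hx, hinf⟩ := hω
    rw [mem_cube] at hx
    have hxB : x ∈ cube d 0 N := mem_cube.2 fun j => by have := hx j; constructor <;> omega
    obtain ⟨y, hy, hyinf⟩ := exists_infinite_compl (cube_finite 0 N)
      ((cube_finite _ _).subset (outerBoundary_cube_subset N)) hxB hinf
    have hy' := mem_cube.1 (outerBoundary_cube_subset N hy)
    have hspos : 0 < s := by omega
    have hlt : ∀ j, ((y j + 1) / s).toNat < q := by
      intro j
      have h1 : (y j + 1) / s < q := by
        rw [Int.ediv_lt_iff_lt_mul hspos]
        have := hy' j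
        omega
      have h2 : 0 ≤ (y j + 1) / s := Int.ediv_nonneg (by have := hy' j; omega) hspos.le
      omega
    -- The cell containing `y` is found by dividing `y j + 1` by `s` in each coordinate.
    refine mem_iUnion.2 ⟨fun j => ⟨_, hlt j⟩, y, ?_, hyinf⟩
    refine mem_cube.2 fun j => ?_
    have h2 : 0 ≤ (y j + 1) / s := Int.ediv_nonneg (by have := hy' j; omega) hspos.le
    simp only [v, Pi.sub_apply, Int.toNat_of_nonneg h2]
    have h3 := Int.emod_add_mul_ediv (y j + 1) s
    have h4 := Int.emod_nonneg (y j + 1) hspos.ne'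
    have h5 := Int.emod_lt_of_pos (y j + 1) hspos
    constructor <;> omega
  have hK : ∀ a, (M.law p).real (M.Infin (cube d 0 N)ᶜ (K a)) ≤ θ := by
    intro a
    refine (M.law_infin_mono p (subset_univ _)).trans_eq ?_
    simp only [K, sub_eq_add_neg]
    exact M.law_infin_translate p (-v a) _
  have hineq : θ ≤ 2 * d * M.crossProb p i₀ m N * q ^ d * θ := by
    calc θ ≤ (M.law p).real (M.shellCross m N ∩ ⋃ a, M.Infin (cube d 0 N)ᶜ (K a)) :=
          measureReal_mono hcover
      _ = (M.law p).real (M.shellCross m N) *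
            (M.law p).real (⋃ a, M.Infin (cube d 0 N)ᶜ (K a)) :=
          M.law_inter p disjoint_compl_right (M.measurableSet_shellCross m N)
            (MeasurableSet.iUnion (m := coordSigma (M.loc (cube d 0 N)ᶜ)) fun a =>
              M.measurableSet_infin _ _)
      _ ≤ (2 * d * M.crossProb p i₀ m N) * (q ^ d * θ) := by
          refine mul_le_mul (M.law_shellCross_le p i₀ (by omega)) ?_ measureReal_nonneg ?_
          · refine (measureReal_iUnion_fintype_le _).trans
              ((Finset.sum_le_sum fun a _ => hK a).trans_eq ?_)
            simp
          · exact mul_nonneg (by positivity) measureReal_nonneg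
      _ = _ := by ring
  have hθ0 : θ = 0 := by
    have : 0 ≤ θ := measureReal_nonneg
    nlinarith
  -- After a translation the origin becomes the corner `(m, …, m)` of the inner cube.
  have h0 : (M.law p).real (M.Infin univ {0}) = 0 := by
    refine le_antisymm ?_ measureReal_nonneg
    rw [← M.law_infin_translate p (fun _ => -m), ← hθ0, hθ]
    refine measureReal_mono ?_
    rintro ω ⟨x, hx, hinf⟩
    refine ⟨x, mem_cube.2 fun j => ?_, hinf⟩
    have := congrFun (show x + (fun _ => -m) = 0 from hx) j
    simp only [Pi.add_apply, Pi.zero_apply] at this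
    constructor <;> omega
  exact (measureReal_eq_zero_iff).1 h0

end Model

/-! ### Crossing probabilities at the critical point -/

namespace Model

variable {d : ℕ} {ι : Type*} (M : Model d ι)

/-- The critical point of a percolation model. -/
noncomputable def pc : unitInterval := sSup {p | M.law p (M.Infin univ {0}) = 0}

lemma joined_base_single (i : Fin d) {m N : ℤ} (hN : 0 ≤ N) (k : ℕ) (hk : k ≤ m) :
    M.Joined M.base (slabZ i m N) 0 (Pi.single i (k : ℤ)) := by
  have hmem : ∀ l : ℕ, (l : ℤ) ≤ m → (Pi.single i (l : ℤ) : Fin d → ℤ) ∈ slabZ i m N := by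
    intro l hl j
    by_cases hj : j = i
    · subst hj; simpa using hl
    · simpa [hj] using hN
  induction k with
  | zero =>
    have h0 := hmem 0 (by simpa using hk)
    simp only [Nat.cast_zero, Pi.single_zero] at h0 ⊢
    exact .refl h0 (M.siteTok_base 0)
  | succ k ih =>
    have hadj : (lattice d).Adj (Pi.single i (k : ℤ)) (Pi.single i ((k + 1 : ℕ) : ℤ)) := by
      change ∑ j, |_| = (1 : ℤ)
      rw [Finset.sum_eq_single i] <;> simp +contextual
    have hk' : (k : ℤ) ≤ m := by push_cast at hk; omega
    exact (ih hk').tail ⟨hadj, hmem _ hk', hmem _ hk, M.bondTok_base hadj⟩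

lemma crossProb_one (i : Fin d) {m N : ℤ} (hm : 0 ≤ m) (hN : 0 ≤ N) :
    M.crossProb 1 i m N = 1 := by
  have h : M.base ∈ M.Cross (slabZ i m N) (face i 0) (face i m) := by
    refine ⟨0, rfl, Pi.single i m, by simp [face], ?_⟩
    have := M.joined_base_single i (m := m) hN m.toNat (by omega)
    rwa [Int.toNat_of_nonneg hm] at this
  rw [crossProb, law, setBernoulli_one, measureReal_def, Measure.dirac_apply_of_mem h]
  rfl

variable [Countable ι]

/-- The lower bound on the crossing probabilities at the critical point. -/
theorem le_crossProb_pc (i₀ : Fin d) {m N : ℤ} (hm : 0 ≤ m) (hmN : 2 * m ≤ N) {q : ℕ}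
    (hq : N + 3 ≤ q * (N - 2 * m + 1)) :
    1 / (2 * d * q ^ d : ℝ) ≤ M.crossProb M.pc i₀ m N := by
  have hq1 : 1 ≤ q := by
    rcases Nat.eq_zero_or_pos q with h | h
    · subst h; simp at hq; omega
    · exact h
  have hd : 1 ≤ d := i₀.pos
  have hq1' : (1 : ℝ) ≤ q := by exact_mod_cast hq1
  have hd' : (1 : ℝ) ≤ d := by exact_mod_cast hd
  have hpow : (1 : ℝ) ≤ (q : ℝ) ^ d := one_le_pow₀ hq1'
  have hden : (1 : ℝ) ≤ 2 * d * q ^ d := by nlinarith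
  by_contra! hlt
  -- If the critical point is 1, there is no density above it to use, but then the crossing is
  -- certain. Otherwise continuity supplies a density above it that still satisfies the criterion.
  rcases eq_or_lt_of_le (unitInterval.le_one' (t := M.pc)) with h1 | h1
  · rw [h1, M.crossProb_one i₀ hm (by omega), lt_div_iff₀ (by linarith)] at hlt
    linarith
  · have hcont : Continuous fun p => M.crossProb p i₀ m N :=
      M.continuous_law_cross (slabZ_finite i₀ m N) _ _
    have hev : ∀ᶠ p in 𝓝[>] M.pc, M.crossProb p i₀ m N < 1 / (2 * d * q ^ d : ℝ) :=
      nhdsWithin_le_nhds (hcont.continuousAt.eventually_lt continuousAt_const hlt)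
    have : (𝓝[>] M.pc).NeBot := nhdsGT_neBot_of_exists_gt ⟨1, h1⟩
    obtain ⟨p, hp, hpc⟩ := (hev.and self_mem_nhdsWithin).exists
    refine absurd (le_sSup (a := p) ?_) (not_le.2 hpc)
    refine M.law_infin_eq_zero p i₀ hm hmN hq ?_
    rw [lt_div_iff₀ (by linarith)] at hp
    linarith

/-- A wide slab contains many disjoint translates of a narrower one. -/
theorem crossProb_ge_of_disjoint_translates (p : unitInterval) (i₀ : Fin d) {m N N' : ℤ} {k : ℕ}
    (hN' : 0 ≤ N') (hk : k * (N' + 1) ≤ N + 1) :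
    1 - (1 - M.crossProb p i₀ m N') ^ k ^ (d - 1) ≤ M.crossProb p i₀ m N := by
  let α := {j : Fin d // j ≠ i₀} → Fin k
  -- The spacing is `N' + 1`, the number of sites across a narrow slab, so that the translates share
  -- no site; direction `i₀` is left alone.
  let v : α → Fin d → ℤ := fun a j => if h : j = i₀ then 0 else (N' + 1) * (a ⟨j, h⟩ : ℕ)
  let S : α → Set (Fin d → ℤ) := fun a => translateIso (-v a) ⁻¹' slabZ i₀ m N'
  let E : α → Set (Set ι) := fun a => M.Cross (S a) (face i₀ 0) (face i₀ m)
  have hE : ∀ a, (M.law p).real (E a) = M.crossProb p i₀ m N' := by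
    intro a
    rw [crossProb, ← M.law_cross_preimage p (translateIso (-v a)) (slabZ i₀ m N')]
    have hf : ∀ c, translateIso (-v a) ⁻¹' face i₀ c = face i₀ c := by
      intro c; ext x; simp [face, v]
    rw [hf, hf]
  have hmemS : ∀ a x, x ∈ S a → ∀ j (h : j ≠ i₀),
      (N' + 1) * (a ⟨j, h⟩ : ℕ) ≤ x j ∧ x j < (N' + 1) * (a ⟨j, h⟩ : ℕ) + (N' + 1) := by
    intro a x hx j h
    have := hx j
    simp only [translateIso_apply, Pi.add_apply, Pi.neg_apply, v, h, dif_neg, not_false_eq_true,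
      if_false] at this
    omega
  have hdisj : Pairwise fun a b => Disjoint (S a) (S b) := by
    intro a b hab
    refine Set.disjoint_left.2 fun x hxa hxb => hab ?_
    funext ⟨j, hj⟩
    obtain ⟨h1, h2⟩ := hmemS a x hxa j hj
    obtain ⟨h3, h4⟩ := hmemS b x hxb j hj
    have hpos : 0 < N' + 1 := by omega
    have h5 : (N' + 1) * ((a ⟨j, hj⟩ : ℕ) : ℤ) < (N' + 1) * (((b ⟨j, hj⟩ : ℕ) : ℤ) + 1) := by
      linarith
    have h6 : (N' + 1) * ((b ⟨j, hj⟩ : ℕ) : ℤ) < (N' + 1) * (((a ⟨j, hj⟩ : ℕ) : ℤ) + 1) := by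
      linarith
    have h7 := lt_of_mul_lt_mul_left h5 hpos.le
    have h8 := lt_of_mul_lt_mul_left h6 hpos.le
    ext
    omega
  have hsub : ∀ a, S a ⊆ slabZ i₀ m N := by
    intro a x hx j
    by_cases h : j = i₀
    · have := hx j
      simpa [v, h] using this
    · obtain ⟨h1, h2⟩ := hmemS a x hx j h
      have h3 : ((a ⟨j, h⟩ : ℕ) : ℤ) + 1 ≤ k := by
        have := (a ⟨j, h⟩).2
        omega
      have h4 : 0 ≤ (N' + 1) * ((a ⟨j, h⟩ : ℕ) : ℤ) := by positivity
      have h5 := mul_le_mul_of_nonneg_left h3 (show 0 ≤ N' + 1 by omega)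
      simp only [h, if_false]
      constructor <;> linarith
  have hmeas : MeasurableSet (M.Cross (slabZ i₀ m N) (face i₀ 0) (face i₀ m)) :=
    coordSigma_le _ _ (M.measurableSet_cross _ _ _)
  have hcompl : (M.law p).real (M.Cross (slabZ i₀ m N) (face i₀ 0) (face i₀ m))ᶜ ≤
      (M.law p).real (⋂ a ∈ (Finset.univ : Finset α), (E a)ᶜ) := by
    refine measureReal_mono fun ω hω => ?_
    simp only [Finset.mem_univ, iInter_true, mem_iInter, mem_compl_iff]
    rintro a ⟨x, hx, y, hy, hj⟩
    exact hω ⟨x, hx, y, hy, hj.mono subset_rfl (hsub a)⟩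
  rw [M.law_iInter_compl p Finset.univ hdisj (E := E) fun a => M.measurableSet_cross _ _ _,
    probReal_compl_eq_one_sub hmeas] at hcompl
  have hcard : Fintype.card α = k ^ (d - 1) := by
    simp [α, Fintype.card_subtype_compl]
  simp only [hE, Finset.prod_const, Finset.card_univ, hcard] at hcompl
  have : M.crossProb p i₀ m N =
    (M.law p).real (M.Cross (slabZ i₀ m N) (face i₀ 0) (face i₀ m)) := rfl
  linarith

end Model

/-! ### Bond and site percolation as models -/

section Instances

/-- Bond percolation as a percolation model. -/
noncomputable def bondModel (d : ℕ) : Model d (Sym2 (Fin d → ℤ)) where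
  base := (lattice d).edgeSet
  siteTok _ := ∅
  bondTok x y := {s(x, y)}
  loc S := {e | ∀ v ∈ e, v ∈ S}
  siteTok_base _ := by simp
  bondTok_base h := by simpa using h
  siteTok_subset _ := by simp
  siteTok_loc _ := by simp
  bondTok_loc hx hy := by simp [hx, hy]
  loc_mono h _ he v hv := h (he v hv)
  loc_disjoint h := by
    refine Set.disjoint_left.2 fun e => ?_
    induction e with
    | _ x y => exact fun h1 h2 => Set.disjoint_left.1 h (h1 x (by simp)) (h2 x (by simp))
  loc_finite {S} hS := by
    refine ((hS.prod hS).image fun z => s(z.1, z.2)).subset fun e => ?_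
    induction e with
    | _ x y => exact fun h => ⟨(x, y), ⟨h x (by simp), h y (by simp)⟩, rfl⟩
  aut φ := by
    refine ⟨⟨Sym2.map φ, Sym2.map φ.symm, fun z => ?_, fun z => ?_⟩, fun i => ?_, fun x => by simp, fun x y => by simp⟩
    · induction z with
      | _ x y => simp
    · induction z with
      | _ x y => simp
    · induction i with
      | _ x y => simpa using φ.map_adj_iff

/-- Site percolation as a percolation model. -/
noncomputable def siteModel (d : ℕ) : Model d (Fin d → ℤ) where
  base := univ
  siteTok x := {x}
  -- Both ends are required, so openness of the arrival site can be read off the step.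
  bondTok x y := {x, y}
  loc S := S
  siteTok_base _ := subset_univ _
  bondTok_base _ := subset_univ _
  siteTok_subset _ := by simp
  siteTok_loc hx := by simpa using hx
  bondTok_loc hx hy := by simp [Set.insert_subset_iff, hx, hy]
  loc_mono h := h
  loc_disjoint h := h
  loc_finite h := h
  aut φ := ⟨φ.toEquiv, by simp, by simp, by simp⟩

variable {d : ℕ} {S : Set (Fin d → ℤ)} {x y : Fin d → ℤ}

lemma Model.Joined.of_walk {ι : Type*} {M : Model d ι} {ω : Set ι} (w : (lattice d).Walk x y)
    (hS : ∀ v ∈ w.support, v ∈ S) (hsite : ∀ v ∈ w.support, (M.siteTok v : Set ι) ⊆ ω)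
    (hbond : ∀ a b, s(a, b) ∈ w.edges → (M.bondTok a b : Set ι) ⊆ ω) : M.Joined ω S x y := by
  refine ⟨hS _ w.start_mem_support, hsite _ w.start_mem_support, ?_⟩
  induction w with
  | nil => exact .refl
  | cons h w ih =>
    refine .head ⟨h, hS _ (by simp), hS _ (by simp), hbond _ _ (by simp)⟩ (ih ?_ ?_ ?_)
    · exact fun v hv => hS v (by simp [hv])
    · exact fun v hv => hsite v (by simp [hv])
    · exact fun a b hab => hbond a b (by simp [hab])

lemma bondModel_joined_iff {ω : Set (Sym2 (Fin d → ℤ))} :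
    (bondModel d).Joined ω S x y ↔ BondJoined ω S x y := by
  constructor
  · intro h
    induction h using Model.Joined.induct with
    | refl hx => exact ⟨.nil, by simp, by simpa using hx⟩
    | tail b c _ hs ih =>
      obtain ⟨w, h1, h2⟩ := ih
      refine ⟨w.concat hs.1, ?_, ?_⟩
      · have := hs.2.2.2
        simp only [bondModel, Finset.coe_singleton, singleton_subset_iff] at this
        intro e he
        simp only [SimpleGraph.Walk.edges_concat, List.concat_eq_append, List.mem_append,
          List.mem_singleton] at he
        rcases he with he | rfl
        exacts [h1 e he, this]
      · intro v hv
        simp only [SimpleGraph.Walk.support_concat, List.mem_append,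
          List.mem_singleton] at hv
        rcases hv with hv | rfl
        exacts [h2 v hv, hs.2.2.1]
  · rintro ⟨w, h1, h2⟩
    exact .of_walk w h2 (by simp [bondModel]) fun a b hab => by simpa [bondModel] using h1 _ hab

lemma siteModel_joined_iff {ω : Set (Fin d → ℤ)} :
    (siteModel d).Joined ω S x y ↔ SiteJoined ω S x y := by
  constructor
  · intro h
    induction h using Model.Joined.induct with
    | refl hx ho => exact ⟨.nil, by simpa [siteModel] using ho, by simpa using hx⟩
    | tail b c _ hs ih =>
      obtain ⟨w, h1, h2⟩ := ih
      refine ⟨w.concat hs.1, ?_, ?_⟩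
      · have := hs.siteTok_right
        simp only [siteModel, Finset.coe_singleton, singleton_subset_iff] at this
        intro v hv
        simp only [SimpleGraph.Walk.support_concat, List.mem_append,
          List.mem_singleton] at hv
        rcases hv with hv | rfl
        exacts [h1 v hv, this]
      · intro v hv
        simp only [SimpleGraph.Walk.support_concat, List.mem_append,
          List.mem_singleton] at hv
        rcases hv with hv | rfl
        exacts [h2 v hv, hs.2.2.1]
  · rintro ⟨w, h1, h2⟩
    refine .of_walk w h2 (by simpa [siteModel] using h1) fun a b hab => ?_
    simp only [siteModel, Finset.coe_insert, Finset.coe_singleton, insert_subset_iff,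
      singleton_subset_iff]
    exact ⟨h1 a (w.fst_mem_support_of_mem_edges hab), h1 b (w.snd_mem_support_of_mem_edges hab)⟩

lemma bondPc_eq : bondPc d = (bondModel d).pc := by
  simp only [bondPc, Model.pc, Model.Infin, bondModel_joined_iff, mem_singleton_iff,
    exists_eq_left]
  rfl

lemma sitePc_eq : sitePc d = (siteModel d).pc := by
  simp only [sitePc, Model.pc, Model.Infin, siteModel_joined_iff, mem_singleton_iff,
    exists_eq_left]
  rfl

lemma slab_eq {i₀ : Fin d} (h : (i₀ : ℕ) = 0) (L t : ℝ) :
    slab d L t = slabZ i₀ ⌊t * L⌋ ⌊L⌋ := by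
  ext x
  refine forall_congr' fun j => and_congr Iff.rfl ?_
  have hj : (j : ℕ) = 0 ↔ j = i₀ := by rw [Fin.ext_iff, h]
  simp only [hj]
  split_ifs <;> exact Int.le_floor.symm

lemma layer_eq {i₀ : Fin d} (h : (i₀ : ℕ) = 0) (k : ℤ) : layer d k = face i₀ k := by
  ext x
  have hj : ∀ j : Fin d, (j : ℕ) = 0 ↔ j = i₀ := fun j => by rw [Fin.ext_iff, h]
  simp [layer, face, hj]

lemma bondR_eq {i₀ : Fin d} (h : (i₀ : ℕ) = 0) (p : unitInterval) (L t : ℝ) :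
    bondR d p L t = (bondModel d).crossProb p i₀ ⌊t * L⌋ ⌊L⌋ := by
  simp only [bondR, Model.crossProb, Model.Cross, bondModel_joined_iff, slab_eq h, layer_eq h]
  rfl

lemma siteR_eq {i₀ : Fin d} (h : (i₀ : ℕ) = 0) (p : unitInterval) (L t : ℝ) :
    siteR d p L t = (siteModel d).crossProb p i₀ ⌊t * L⌋ ⌊L⌋ := by
  simp only [siteR, Model.crossProb, Model.Cross, siteModel_joined_iff, slab_eq h, layer_eq h]
  rfl

/-- The two faces coincide and a path of length zero uses no bond. Site percolation lacks this,
since even such a path needs an open site. -/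
lemma bondModel_crossProb_zero (p : unitInterval) (i : Fin d) {N : ℤ} (hN : 0 ≤ N) :
    (bondModel d).crossProb p i 0 N = 1 := by
  have h : (bondModel d).Cross (slabZ i 0 N) (face i 0) (face i 0) = univ := by
    refine eq_univ_of_forall fun ω => ⟨0, rfl, 0, rfl, .refl (fun j => ?_) (by simp [bondModel])⟩
    by_cases hj : j = i <;> simp [hj, hN]
  rw [Model.crossProb, h, probReal_univ]

end Instances

/-! ### Bounds in terms of the aspect ratio, and the monotone envelope -/

section Bounds

variable {d : ℕ} {ι : Type*} [Countable ι] (M : Model d ι)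

/-- A lower bound on the crossing probability of slabs of aspect ratio at least `1 / t`. -/
noncomputable def crossBound (d : ℕ) (t : ℝ) : ℝ := 1 / (2 * d * (⌈6 / (1 - 2 * t)⌉₊ : ℝ) ^ d)

lemma crossBound_pos (hd : 0 < d) {t : ℝ} (ht : t < 1 / 2) : 0 < crossBound d t := by
  have h : 0 < 1 - 2 * t := by linarith
  have : 0 < ⌈6 / (1 - 2 * t)⌉₊ := Nat.ceil_pos.2 (by positivity)
  unfold crossBound
  positivity

lemma crossBound_anti (hd : 0 < d) {s t : ℝ} (hst : s ≤ t) (ht : t < 1 / 2) :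
    crossBound d t ≤ crossBound d s := by
  have h : 0 < 1 - 2 * t := by linarith
  have h' : 0 < 1 - 2 * s := by linarith
  have : 0 < ⌈6 / (1 - 2 * s)⌉₊ := Nat.ceil_pos.2 (by positivity)
  have h2 : ⌈6 / (1 - 2 * s)⌉₊ ≤ ⌈6 / (1 - 2 * t)⌉₊ := Nat.ceil_mono (by gcongr)
  unfold crossBound
  gcongr

/-- Since `m ≤ tL` and `L < N + 1`, one has `N - 2m + 1 ≥ (1 - 2t)(N + 1)`, so a `q` of order `1 /
(1 - 2t)` works for every `L`. The constant 6 is not optimal. -/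
lemma Model.crossBound_le (i₀ : Fin d) {t L : ℝ} (ht0 : 0 ≤ t) (ht : t < 1 / 2) (hL : 0 < L) :
    crossBound d t ≤ M.crossProb M.pc i₀ ⌊t * L⌋ ⌊L⌋ := by
  have h : 0 < 1 - 2 * t := by linarith
  set m := ⌊t * L⌋ with hm
  set N := ⌊L⌋ with hN
  have hm0 : 0 ≤ m := Int.floor_nonneg.2 (by positivity)
  have hN0 : 0 ≤ N := Int.floor_nonneg.2 hL.le
  have hmle : (m : ℝ) ≤ t * L := Int.floor_le _
  have hNle : (N : ℝ) ≤ L := Int.floor_le _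
  have hNlt : L < N + 1 := Int.lt_floor_add_one _
  have hmN : 2 * m ≤ N := by
    refine Int.le_floor.2 ?_
    push_cast
    nlinarith
  refine M.le_crossProb_pc i₀ hm0 hmN (q := ⌈6 / (1 - 2 * t)⌉₊) ?_
  have hq : 6 / (1 - 2 * t) ≤ (⌈6 / (1 - 2 * t)⌉₊ : ℝ) := Nat.le_ceil _
  have hs : (1 : ℝ) ≤ N - 2 * m + 1 := by
    have : (2 * m : ℝ) ≤ N := by exact_mod_cast hmN
    linarith
  have key : (N + 3 : ℝ) ≤ (⌈6 / (1 - 2 * t)⌉₊ : ℝ) * (N - 2 * m + 1) := by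
    refine le_trans ?_ (mul_le_mul_of_nonneg_right hq (by linarith))
    rw [div_mul_eq_mul_div, le_div_iff₀ h]
    rcases hN0.eq_or_lt with h0 | h0
    · have : (N : ℝ) = 0 := by exact_mod_cast h0.symm
      nlinarith
    · have : (1 : ℝ) ≤ N := by exact_mod_cast h0
      nlinarith
  exact_mod_cast key

/-- The exponential lower bound for flat slabs. -/
lemma Model.exp_bound_le (i₀ : Fin d) {t L : ℝ} (ht0 : 0 < t) (ht : t ≤ 1 / 10)
    (hL : 1 ≤ t * L) :
    1 - Real.exp (-(crossBound d (1 / 4) / 10 ^ (d - 1)) * (1 / t) ^ (d - 1)) ≤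
      M.crossProb M.pc i₀ ⌊t * L⌋ ⌊L⌋ := by
  have hL0 : 0 < L := by by_contra! h; nlinarith
  have hd : 0 < d := i₀.pos
  set r := crossBound d (1 / 4) with hr
  have hr0 : 0 < r := crossBound_pos hd (by norm_num)
  -- A narrow slab of width `4tL` occupies at most `4tL + 1 ≤ 5tL` sites across, because `tL ≥ 1`;
  -- so `1 / (5t)` of them fit, up to rounding.
  set k := ⌊1 / (5 * t)⌋₊ with hk
  have hkle : (k : ℝ) ≤ 1 / (5 * t) := Nat.floor_le (by positivity)
  have hklt : 1 / (5 * t) < k + 1 := Nat.lt_floor_add_one _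
  -- Rounding down loses less than 1, which is at most `1 / (10t)` as `t ≤ 1/10`.
  have hkge : 1 / (10 * t) ≤ k := by
    have h1 : 1 / (5 * t) = 1 / (10 * t) + 1 / (10 * t) := by field_simp; norm_num
    have h2 : 1 ≤ 1 / (10 * t) := by rw [le_div_iff₀ (by positivity)]; linarith
    linarith
  have hcross : r ≤ M.crossProb M.pc i₀ ⌊t * L⌋ ⌊4 * (t * L)⌋ := by
    have := M.crossBound_le i₀ (t := 1 / 4) (L := 4 * (t * L)) (by norm_num) (by norm_num)
      (by positivity)
    rwa [show 1 / 4 * (4 * (t * L)) = t * L by ring] at this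
  have hmain := M.crossProb_ge_of_disjoint_translates M.pc i₀ (m := ⌊t * L⌋) (N := ⌊L⌋)
    (N' := ⌊4 * (t * L)⌋) (k := k) (Int.floor_nonneg.2 (by positivity)) (by
      have h1 : ((⌊4 * (t * L)⌋ : ℤ) : ℝ) ≤ 4 * (t * L) := Int.floor_le _
      have h2 : L < ⌊L⌋ + 1 := Int.lt_floor_add_one _
      have h3 : (k : ℝ) * (⌊4 * (t * L)⌋ + 1) ≤ 1 / (5 * t) * (5 * (t * L)) :=
        mul_le_mul hkle (by linarith) (by
          have : (0 : ℝ) ≤ ⌊4 * (t * L)⌋ := by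
            exact_mod_cast Int.floor_nonneg.2 (by positivity)
          linarith) (by positivity)
      have h4 : 1 / (5 * t) * (5 * (t * L)) = L := by field_simp
      have h5 : (k : ℝ) * (⌊4 * (t * L)⌋ + 1) ≤ ⌊L⌋ + 1 := by linarith
      exact_mod_cast h5)
  refine le_trans ?_ hmain
  have hle1 : M.crossProb M.pc i₀ ⌊t * L⌋ ⌊4 * (t * L)⌋ ≤ 1 := measureReal_le_one
  -- With `1 - r ≤ exp (-r)`, the probability that all `k^(d-1)` narrow slabs fail is at most `exp
  -- (-r k^(d-1))`.
  have h1 : 1 - M.crossProb M.pc i₀ ⌊t * L⌋ ⌊4 * (t * L)⌋ ≤ Real.exp (-r) := by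
    have := Real.add_one_le_exp (-r)
    linarith
  have h2 := pow_le_pow_left₀ (by linarith) h1 (k ^ (d - 1))
  rw [← Real.exp_nat_mul] at h2
  have h3 : Real.exp (((k ^ (d - 1) : ℕ) : ℝ) * -r) ≤
      Real.exp (-(r / 10 ^ (d - 1)) * (1 / t) ^ (d - 1)) := by
    refine Real.exp_le_exp.2 ?_
    have h4 : (1 / (10 * t)) ^ (d - 1) ≤ (k : ℝ) ^ (d - 1) := by gcongr
    have h5 : -(r / 10 ^ (d - 1)) * (1 / t) ^ (d - 1) = (1 / (10 * t)) ^ (d - 1) * -r := by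
      rw [one_div, one_div, inv_pow, inv_pow, mul_pow]
      field_simp
    rw [h5]
    push_cast
    nlinarith
  linarith

/-- The largest non-increasing function of `t` that is at most `R L t` for all `L > 0`. -/
noncomputable def lowerEnvelope (R : ℝ → ℝ → ℝ) (t : ℝ) : ℝ :=
  sInf {r | ∃ s, 0 ≤ s ∧ s ≤ t ∧ ∃ L, 0 < L ∧ r = R L s}

section Envelope

variable {R : ℝ → ℝ → ℝ}

lemma lowerEnvelope_le (hR : ∀ L t, 0 ≤ R L t) {t L : ℝ} (ht : 0 ≤ t) (hL : 0 < L) :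
    lowerEnvelope R t ≤ R L t :=
  csInf_le ⟨0, by rintro r ⟨s, -, -, L, -, rfl⟩; exact hR L s⟩ ⟨t, ht, le_rfl, L, hL, rfl⟩

lemma le_lowerEnvelope {t c : ℝ} (ht : 0 ≤ t) (h : ∀ s, 0 ≤ s → s ≤ t → ∀ L, 0 < L → c ≤ R L s) :
    c ≤ lowerEnvelope R t := by
  refine le_csInf ⟨_, t, ht, le_rfl, 1, one_pos, rfl⟩ ?_
  rintro r ⟨s, hs, hst, L, hL, rfl⟩
  exact h s hs hst L hL

lemma antitoneOn_lowerEnvelope (hR : ∀ L t, 0 ≤ R L t) :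
    AntitoneOn (lowerEnvelope R) (Ici 0) := by
  intro s hs t _ hst
  refine le_lowerEnvelope hs fun a ha has L hL => ?_
  exact csInf_le ⟨0, by rintro r ⟨s, -, -, L, -, rfl⟩; exact hR L s⟩
    ⟨a, ha, has.trans hst, L, hL, rfl⟩

end Envelope

/-- `crossBound` decreases in the aspect ratio, so its value at `t` bounds all the probabilities in
the infimum at once. -/
lemma lowerEnvelope_pos (hd : 0 < d) {R : ℝ → ℝ → ℝ}
    (hR : ∀ L t, 0 < L → 0 ≤ t → t < 1 / 2 → crossBound d t ≤ R L t) {t : ℝ} (ht0 : 0 ≤ t)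
    (ht : t < 1 / 2) : 0 < lowerEnvelope R t :=
  (crossBound_pos hd ht).trans_le <| le_lowerEnvelope ht0 fun s hs hst L hL =>
    (crossBound_anti hd hst ht).trans (hR L s hL hs (hst.trans_lt ht))

end Bounds

/-! ### The two models at criticality -/

section Main

lemma eventually_small : ∀ᶠ t : ℝ in 𝓝[>] 0, 0 < t ∧ t ≤ 1 / 10 := by
  filter_upwards [Ioc_mem_nhdsGT (show (0 : ℝ) < 1 / 10 by norm_num)] with t ht using ht

theorem exists_bond_crossing_bound {d : ℕ} (hd : 0 < d) :
    ∃ h : ℝ → ℝ, AntitoneOn h (Ici 0) ∧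
      (∀ t : ℝ, 0 ≤ t → t < 1 / 2 → 0 < h t) ∧
      (∀ t : ℝ, 0 ≤ t → ∀ L : ℝ, 0 < L → h t ≤ bondR d (bondPc d) L t) ∧
      ∃ A c : ℝ, 0 < A ∧ 0 < c ∧
        ∀ᶠ t : ℝ in 𝓝[>] 0, 1 - A * Real.exp (-c * (1 / t) ^ (d - 1)) ≤ h t := by
  let i₀ : Fin d := ⟨0, hd⟩
  have hi₀ : (i₀ : ℕ) = 0 := rfl
  have hc : 0 < crossBound d (1 / 4) / 10 ^ (d - 1) :=
    div_pos (crossBound_pos hd (by norm_num)) (by positivity)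
  refine ⟨lowerEnvelope (bondR d (bondPc d)), antitoneOn_lowerEnvelope fun _ _ =>
    measureReal_nonneg, fun t => lowerEnvelope_pos hd fun L s hL hs0 hs => ?_,
    fun t ht L => lowerEnvelope_le (fun _ _ => measureReal_nonneg) ht,
    1, _, one_pos, hc, ?_⟩
  · rw [bondR_eq hi₀, bondPc_eq]
    exact (bondModel d).crossBound_le i₀ hs0 hs hL
  · filter_upwards [eventually_small] with t ht
    refine le_lowerEnvelope ht.1.le fun s hs hst L hL => ?_
    rw [bondR_eq hi₀, bondPc_eq, one_mul]
    -- The envelope at `t` involves every `s ≤ t`. Slabs at least one spacing thick obey the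
    -- exponential bound, which only improves as `s` decreases; thinner ones are crossed trivially.
    rcases le_or_gt 1 (s * L) with h1 | h1
    · have hs' : 0 < s := hs.lt_of_ne (by rintro rfl; norm_num at h1)
      refine le_trans ?_ ((bondModel d).exp_bound_le i₀ hs' (hst.trans ht.2) h1)
      have h2 : (1 / t) ^ (d - 1) ≤ (1 / s) ^ (d - 1) := by
        have := ht.1
        gcongr
      refine sub_le_sub_left (Real.exp_le_exp.2 ?_) 1
      nlinarith
    · have h0 : ⌊s * L⌋ = 0 := Int.floor_eq_zero_iff.2 ⟨by positivity, h1⟩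
      rw [h0, bondModel_crossProb_zero _ _ (Int.floor_nonneg.2 hL.le)]
      linarith [Real.exp_pos (-(crossBound d (1 / 4) / 10 ^ (d - 1)) * (1 / t) ^ (d - 1))]

/-- The exponential bound is not asked of `h` here: for `L < 1` and `t ≤ 1` the slab is a single
site, crossed with probability equal to the density. -/
theorem exists_site_crossing_bound {d : ℕ} (hd : 0 < d) :
    ∃ h : ℝ → ℝ, AntitoneOn h (Ici 0) ∧
      (∀ t : ℝ, 0 ≤ t → t < 1 / 2 → 0 < h t) ∧
      (∀ t : ℝ, 0 ≤ t → ∀ L : ℝ, 0 < L → h t ≤ siteR d (sitePc d) L t) ∧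
      ∃ A c : ℝ, 0 < A ∧ 0 < c ∧
        ∀ᶠ t : ℝ in 𝓝[>] 0, ∀ L : ℝ, 1 ≤ t * L →
          1 - A * Real.exp (-c * (1 / t) ^ (d - 1)) ≤ siteR d (sitePc d) L t := by
  let i₀ : Fin d := ⟨0, hd⟩
  have hi₀ : (i₀ : ℕ) = 0 := rfl
  have hc : 0 < crossBound d (1 / 4) / 10 ^ (d - 1) :=
    div_pos (crossBound_pos hd (by norm_num)) (by positivity)
  refine ⟨lowerEnvelope (siteR d (sitePc d)), antitoneOn_lowerEnvelope fun _ _ =>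
    measureReal_nonneg, fun t => lowerEnvelope_pos hd fun L s hL hs0 hs => ?_,
    fun t ht L => lowerEnvelope_le (fun _ _ => measureReal_nonneg) ht,
    1, _, one_pos, hc, ?_⟩
  · rw [siteR_eq hi₀, sitePc_eq]
    exact (siteModel d).crossBound_le i₀ hs0 hs hL
  · filter_upwards [eventually_small] with t ht L hL
    rw [siteR_eq hi₀, sitePc_eq, one_mul]
    exact (siteModel d).exp_bound_le i₀ ht.1 ht.2 hL

end Main

end Percolation

theorem theorem1 (d : ℕ) (hd : 1 < d) :
    (∃ h : ℝ → ℝ, AntitoneOn h (Set.Ici 0) ∧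
      (∀ t : ℝ, 0 ≤ t → t < 1 / 2 → 0 < h t) ∧
      (∀ t : ℝ, 0 ≤ t → ∀ L : ℝ, 0 < L →
        h t ≤ Percolation.bondR d (Percolation.bondPc d) L t) ∧
      ∃ A c : ℝ, 0 < A ∧ 0 < c ∧
        ∀ᶠ t : ℝ in 𝓝[>] 0, 1 - A * Real.exp (-c * (1 / t) ^ (d - 1)) ≤ h t) ∧
    (∃ h : ℝ → ℝ, AntitoneOn h (Set.Ici 0) ∧
      (∀ t : ℝ, 0 ≤ t → t < 1 / 2 → 0 < h t) ∧
      (∀ t : ℝ, 0 ≤ t → ∀ L : ℝ, 0 < L →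
        h t ≤ Percolation.siteR d (Percolation.sitePc d) L t) ∧
      ∃ A c : ℝ, 0 < A ∧ 0 < c ∧
        ∀ᶠ t : ℝ in 𝓝[>] 0, ∀ L : ℝ, 1 ≤ t * L →
          1 - A * Real.exp (-c * (1 / t) ^ (d - 1)) ≤
            Percolation.siteR d (Percolation.sitePc d) L t) :=
  ⟨Percolation.exists_bond_crossing_bound (by omega),
    Percolation.exists_site_crossing_bound (by omega)⟩
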